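/- Consider a Markov decision process with finite state space $\mathcal S$, finite action space $\mathcal A$, initial distribution $\mu_0$, transition probabilities $P(s'\mid s,a)$ and discount factor $\gamma\in[0,1)$. For a stationary stochastic policy $\pi(a\mid s)$ let $\mu_t^\pi$ be the distribution of the state at time $t$, let $\rho_\pi(s)=\sum_{t\ge 0}\gamma^t\mu_t^\pi(s)$ and let $\rho_\pi(s,a)=\pi(a\mid s)\rho_\pi(s)$. A policy is MCE-optimal for a reward function $r:\mathcal S\times\mathcal A\to\mathbb R$ if it maximizes $$J_r(\pi)=\sum_{s}\rho_\pi(s)\,H(\pi(\cdot\mid s))+\sum_{s,a}\rho_\pi(s,a)\,r(s,a)$$ over all stationary stochastic policies, where $H$ is the Shannon entropy. Let $\rho_E=\rho_{\pi_E}$ be the occupancy of an expert policy $\pi_E$, let $\beta\in\mathbb R$, let $\pi^{(i)}$ be MCE-optimal for a reward function $r^{(i)}$, and put $\rho^{(i)}=\rho_{\pi^{(i)}}$. For a step size $\epsilon$ define the reward update $$\mathcal U_\epsilon r^{(i)}=(1-\epsilon)\,r^{(i)}+\epsilon\,\beta\log\frac{\rho_E}{\rho^{(i)}},$$ where the logarithm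 is read as $0$ at pairs $(s,a)$ at which $\rho_E$ or $\rho^{(i)}$ vanishes. Let $\epsilon>0$, $\zeta>0$ and $\tilde r^{(i+1)}=\mathcal U_\epsilon r^{(i)}$, and let $\pi_{\mathrm{tr}}^{(i+1)}$ be a trust-region optimal policy for $\tilde r^{(i+1)}$, that is, a maximizer of $J_{\tilde r^{(i+1)}}(\pi)$ over the policies $\pi$ with $$D(\pi):=\sum_s\rho_\pi(s)\,\mathrm{KL}\big(\pi(\cdot\mid s)\,\|\,\pi^{(i)}(\cdot\mid s)\big)\le\zeta .$$ Call $\eta\ge 0$ a Lagrange multiplier of the trust-region constraint at $\pi_{\mathrm{tr}}^{(i+1)}$ if $\pi_{\mathrm{tr}}^{(i+1)}$ maximizes $J_{\tilde r^{(i+1)}}(\pi)+\eta\,(\zeta-D(\pi))$ over all policies $\pi$ and $\eta\,(\zeta-D(\pi_{\mathrm{tr}}^{(i+1)}))=0$. Then a Lagrange multiplier exists, and for every Lagrange multiplier $\eta$ the step size $\epsilon_{\mathrm{tr}}=\epsilon/(1+\eta)$ satisfies $0<\epsilon_{\mathrm{tr}}\le\epsilon$, and $\pi_{\mathrm{tr}}^{(i+1)}$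 is MCE-optimal for the corrected reward function $$r^{(i+1)}=\mathcal U_{\epsilon_{\mathrm{tr}}}r^{(i)}=(1-\epsilon_{\mathrm{tr}})\,r^{(i)}+\epsilon_{\mathrm{tr}}\,\beta\log\frac{\rho_E}{\rho^{(i)}} .$$ -/

import Mathlib

open scoped BigOperators

namespace TRIRL

noncomputable section

/-- A reward-free finite Markov decision process with discount factor `γ ∈ [0, 1)`:
`init` is the initial state distribution and `trans s a s'` the probability of moving to `s'`
when the action `a` is taken in the state `s`. -/
structure MDP (S A : Type*) [Fintype S] [Fintype A] where
  init : S → ℝ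
  init_nonneg : ∀ s, 0 ≤ init s
  init_sum : ∑ s, init s = 1
  trans : S → A → S → ℝ
  trans_nonneg : ∀ s a s', 0 ≤ trans s a s'
  trans_sum : ∀ s a, ∑ s', trans s a s' = 1
  γ : ℝ
  γ_nonneg : 0 ≤ γ
  γ_lt_one : γ < 1

/-- A stationary stochastic policy; `π s a` is the probability `π(a | s)`. -/
structure Policy (S A : Type*) [Fintype A] where
  prob : S → A → ℝ
  prob_nonneg : ∀ s a, 0 ≤ prob s a
  prob_sum : ∀ s, ∑ a, prob s a = 1

instance {S A : Type*} [Fintype A] : CoeFun (Policy S A) (fun _ => S → A → ℝ) :=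
  ⟨Policy.prob⟩

/-- Shannon entropy of a probability vector on a finite set (with `0 log 0 = 0`). -/
def entropy {A : Type*} [Fintype A] (p : A → ℝ) : ℝ :=
  -∑ a, p a * Real.log (p a)

open Classical in
/-- Kullback-Leibler divergence `KL(p ‖ q)` of probability vectors on a finite set; it is `+∞`
unless `p` is absolutely continuous with respect to `q`. -/
def kl {A : Type*} [Fintype A] (p q : A → ℝ) : EReal :=
  if ∀ a, q a = 0 → p a = 0 then ((∑ a, p a * Real.log (p a / q a) : ℝ) : EReal) else ⊤

namespace MDP

variable {S A : Type*} [Fintype S] [Fintype A] (M : MDP S A)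

/-- The distribution `μ_t^π` of the state at time `t` under the policy `π`. -/
def stateDist (π : Policy S A) : ℕ → S → ℝ
  | 0 => M.init
  | t + 1 => fun s' => ∑ s, stateDist π t s * ∑ a, π s a * M.trans s a s'

/-- The discounted state occupancy `ρ_π(s) = ∑_t γ^t μ_t^π(s)`. -/
def stateOcc (π : Policy S A) (s : S) : ℝ :=
  ∑' t : ℕ, M.γ ^ t * M.stateDist π t s

/-- The discounted state-action occupancy `ρ_π(s, a) = π(a | s) ρ_π(s)`. -/
def occ (π : Policy S A) (s : S) (a : A) : ℝ :=
  π s a * M.stateOcc π s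

/-- The maximum-causal-entropy objective
`E_{ρ_π(s)}[H(π(· | s))] + E_{ρ_π(s)}[E_π[r(s, a)]]` for the reward function `r`. -/
def mceObjective (r : S → A → ℝ) (π : Policy S A) : ℝ :=
  ∑ s, M.stateOcc π s * entropy (π s) + ∑ s, M.stateOcc π s * ∑ a, π s a * r s a

/-- `π` is an optimal maximum-causal-entropy policy for `r`. -/
def IsMCEOptimal (r : S → A → ℝ) (π : Policy S A) : Prop :=
  ∀ π' : Policy S A, M.mceObjective r π' ≤ M.mceObjective r π

/-- The expected reverse divergence `E_{ρ_π(s)}[KL(π(· | s) ‖ π₀(· | s))]`, where `ρ_π` is the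
occupancy of `π` itself (with `0 · ∞ = 0`). -/
def expectedKL (π π₀ : Policy S A) : EReal :=
  ∑ s, (M.stateOcc π s : EReal) * kl (π s) (π₀ s)

/-- `π` is optimal for the maximum-causal-entropy problem with reward `r`, subject to the
trust-region constraint `E_{ρ_π(s)}[KL(π ‖ π₀)] ≤ ζ`. -/
def IsTrustRegionOptimal (r : S → A → ℝ) (π₀ : Policy S A) (ζ : ℝ) (π : Policy S A) : Prop :=
  M.expectedKL π π₀ ≤ (ζ : EReal) ∧
    ∀ π' : Policy S A, M.expectedKL π' π₀ ≤ (ζ : EReal) →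
      M.mceObjective r π' ≤ M.mceObjective r π

/-- The Lagrangian `L(π, η)` of the trust-region problem. -/
def lagrangian (r : S → A → ℝ) (π₀ : Policy S A) (ζ η : ℝ) (π : Policy S A) : EReal :=
  (M.mceObjective r π : EReal) + (η : EReal) * ((ζ : EReal) - M.expectedKL π π₀)

/-- `η` is a Lagrange multiplier of the trust-region constraint at the policy `π`: it is
nonnegative, `π` maximizes the Lagrangian `L(·, η)` over all policies, and complementary
slackness holds. -/
def IsLagrangeMultiplier (r : S → A → ℝ) (π₀ : Policy S A) (ζ : ℝ) (π : Policy S A)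
    (η : ℝ) : Prop :=
  0 ≤ η ∧
    (∀ π' : Policy S A, M.lagrangian r π₀ ζ η π' ≤ M.lagrangian r π₀ ζ η π) ∧
    (η : EReal) * ((ζ : EReal) - M.expectedKL π π₀) = 0

/-- The function-space reward update with step size `ε`, expert policy `πE` and current policy
`π₀`: `r - ε (r - β log (ρ_E / ρ_{π₀}))`. -/
def rewardUpdate (ε β : ℝ) (πE π₀ : Policy S A) (r : S → A → ℝ) (s : S) (a : A) : ℝ :=
  r s a - ε * (r s a - β * Real.log (M.occ πE s a / M.occ π₀ s a))

end MDP

end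

end TRIRL

/-!
The argument rests on one identity: if `π₀` is optimal for the maximum-causal-entropy objective
with reward `r`, then `E_{ρ_π}[KL(π ‖ π₀)] = J_r(π₀) - J_r(π)` for every policy `π`
(`MDP.expectedKL_eq`). To see it, let `v` be the fixed point of the soft Bellman operator
`v ↦ log ∑ₐ exp (r + γ P v)`, a contraction, and let `π*(a | s) = exp (r + γ P v - v)` be the
associated Boltzmann policy. The flow equation `ρ_π = μ₀ + γ ρ_π P_π` telescopes the logarithm of
`π*` and gives `J_r(π) = ⟨μ₀, v⟩ - E_{ρ_π}[KL(π ‖ π*)]`. By Gibbs' inequality an optimal `π₀`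
agrees with `π*` at all states it visits. There it has full support, so the states it does
not visit are visited by no policy, and `π*` may be replaced by `π₀` in the identity.

Consequently the Lagrangian of the trust-region problem with reward `r̃` is, up to a constant,
`J_{r̃} + η J_r = (1 + η) J_{(r̃ + η r) / (1 + η)}`, and for `r̃ = U_ε r` the averaged reward is
`U_{ε / (1 + η)} r`; this is the assertion about a given multiplier.

For the existence of a multiplier, every `J_r` is concave in the occupancy measure: convex
combinations of occupancies are occupancies, by uniqueness of the solution of the flow equation,
and the entropy is concave (`MDP.exists_mixture`). Hence so is `-E_{ρ_π}[KL(π ‖ π₀)]`, and since `π₀`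
satisfies the constraint strictly, the infimum of the slopes `(J* - J(π)) / (ζ - D(π))` over
strictly feasible policies is a multiplier (`exists_multiplier_of_concave`).
-/

namespace TRIRL

open Finset
open Real (log exp negMulLog log_le_sub_one_of_pos log_lt_sub_one_of_pos log_inv log_div log_exp
  exp_log exp_add exp_sub exp_pos exp_le_exp log_le_iff_le_exp concaveOn_negMulLog)

/-! ### Gibbs' inequality -/

section Gibbs

variable {A : Type*} [Fintype A]

/-- The real-valued Kullback-Leibler sum `∑ p log (p / q)`. It is the divergence whenever `p` is
absolutely continuous with respect to `q`; otherwise it is not meaningful. -/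
noncomputable def klReal (p q : A → ℝ) : ℝ :=
  ∑ a, p a * log (p a / q a)

theorem kl_of_pos {p q : A → ℝ} (hq : ∀ a, 0 < q a) : kl p q = (klReal p q : EReal) := by
  rw [kl, if_pos (fun a h => absurd h (hq a).ne')]
  rfl

theorem sub_le_mul_log_div {x y : ℝ} (hx : 0 ≤ x) (hy : 0 < y) : x - y ≤ x * log (x / y) := by
  rcases hx.eq_or_lt with rfl | hx
  · simpa using hy.le
  · have h := log_le_sub_one_of_pos (div_pos hy hx)
    rw [← neg_le_neg_iff, ← log_inv, inv_div] at h
    calc x - y = x * -(y / x - 1) := by field_simp; ring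
      _ ≤ x * log (x / y) := mul_le_mul_of_nonneg_left h hx.le

theorem eq_of_mul_log_div_eq {x y : ℝ} (hx : 0 ≤ x) (hy : 0 < y)
    (h : x * log (x / y) = x - y) : x = y := by
  rcases hx.eq_or_lt with rfl | hx
  · linarith [zero_mul (log (0 / y))]
  · by_contra hne
    have hlt := log_lt_sub_one_of_pos (div_pos hy hx)
      (fun h1 => hne ((div_eq_one_iff_eq hx.ne').1 h1).symm)
    rw [← neg_lt_neg_iff, ← log_inv, inv_div] at hlt
    have : x - y < x * log (x / y) := by
      calc x - y = x * -(y / x - 1) := by field_simp; ring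
        _ < x * log (x / y) := mul_lt_mul_of_pos_left hlt hx
    exact this.ne' h

theorem klReal_nonneg {p q : A → ℝ} (hp : ∀ a, 0 ≤ p a) (hq : ∀ a, 0 < q a)
    (hpq : ∑ a, p a = ∑ a, q a) : 0 ≤ klReal p q := by
  have h : ∑ a, (p a - q a) ≤ klReal p q :=
    sum_le_sum fun a _ => sub_le_mul_log_div (hp a) (hq a)
  rwa [sum_sub_distrib, hpq, sub_self] at h

theorem eq_of_klReal_eq_zero {p q : A → ℝ} (hp : ∀ a, 0 ≤ p a) (hq : ∀ a, 0 < q a)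
    (hpq : ∑ a, p a = ∑ a, q a) (h : klReal p q = 0) : p = q := by
  have hsum : ∑ a, (p a - q a) = ∑ a, p a * log (p a / q a) := by
    rw [sum_sub_distrib, hpq, sub_self]
    exact h.symm
  have := (sum_eq_sum_iff_of_le fun a _ => sub_le_mul_log_div (hp a) (hq a)).1 hsum
  exact funext fun a => eq_of_mul_log_div_eq (hp a) (hq a) (this a (mem_univ a)).symm

theorem klReal_self (p : A → ℝ) : klReal p p = 0 := by
  refine sum_eq_zero fun a _ => ?_
  by_cases h : p a = 0
  · simp [h]
  · simp [div_self h]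

end Gibbs

/-! ### Lagrange multipliers for concave problems -/

/-- Strong duality for one constraint. If any two points have, for each weight, a mixture
at which `f` is at least and `g` at most the weighted mean, then a maximizer of `f` under the
constraint `g ≤ ζ` has a multiplier as soon as some point satisfies the constraint strictly. -/
theorem exists_multiplier_of_concave {X : Type*} {f g : X → ℝ} {ζ : ℝ} {x₀ x : X}
    (hmix : ∀ y z : X, ∀ t : ℝ, 0 ≤ t → t ≤ 1 →
      ∃ w, t * f y + (1 - t) * f z ≤ f w ∧ g w ≤ t * g y + (1 - t) * g z)
    (hx₀ : g x₀ < ζ) (hx : g x ≤ ζ) (hmax : ∀ y, g y ≤ ζ → f y ≤ f x) :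
    ∃ η : ℝ, 0 ≤ η ∧ (∀ y, f y + η * (ζ - g y) ≤ f x) ∧ η * (ζ - g x) = 0 := by
  set T : Set ℝ := {c | ∃ z, g z < ζ ∧ c = (f x - f z) / (ζ - g z)} with hT
  have hT0 : ∀ c ∈ T, 0 ≤ c := by
    rintro c ⟨z, hz, rfl⟩
    exact div_nonneg (sub_nonneg.2 (hmax z hz.le)) (sub_pos.2 hz).le
  have hbdd : BddBelow T := ⟨0, hT0⟩
  have hne : T.Nonempty := ⟨_, x₀, hx₀, rfl⟩
  have hη : 0 ≤ sInf T := le_csInf hne hT0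
  have hle : ∀ z, g z < ζ → f z + sInf T * (ζ - g z) ≤ f x := by
    intro z hz
    have h := (le_div_iff₀ (sub_pos.2 hz)).1 (csInf_le hbdd ⟨z, hz, rfl⟩)
    linarith
  refine ⟨sInf T, hη, fun y => ?_, ?_⟩
  · rcases lt_trichotomy (g y) ζ with hy | hy | hy
    · exact hle y hy
    · simpa [hy] using hmax y hy.le
    · have h : (f y - f x) / (g y - ζ) ≤ sInf T := by
        refine le_csInf hne ?_
        rintro c ⟨z, hz, rfl⟩
        have hd : 0 < g y - g z := by linarith
        -- The weight for which the mixture of `y` and `z` meets the constraint with equality.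
        obtain ⟨w, hw, hw'⟩ := hmix y z ((ζ - g z) / (g y - g z))
          (div_nonneg (by linarith) hd.le) ((div_le_one hd).2 (by linarith))
        have hmean : (ζ - g z) / (g y - g z) * g y + (1 - (ζ - g z) / (g y - g z)) * g z = ζ := by
          field_simp
          ring
        have hfw := hw.trans (hmax w (hw'.trans hmean.le))
        have hfm : (ζ - g z) / (g y - g z) * f y + (1 - (ζ - g z) / (g y - g z)) * f z
            = ((ζ - g z) * f y + (g y - ζ) * f z) / (g y - g z) := by
          field_simp
          ring
        rw [hfm, div_le_iff₀ hd] at hfw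
        rw [div_le_div_iff₀ (by linarith) (by linarith)]
        nlinarith
      have h' := (div_le_iff₀ (sub_pos.2 hy)).1 h
      linarith
  · rcases hx.lt_or_eq with h | h
    · have h1 := hle x h
      have h2 := mul_nonneg hη (sub_pos.2 h).le
      linarith
    · simp [h]

namespace MDP

variable {S A : Type*} [Fintype S] [Fintype A] (M : MDP S A)

/-! ### Occupancies and the flow equation -/

/-- The state transition kernel `P_π(s' | s) = ∑ₐ π(a | s) P(s' | s, a)` of a policy. -/
def kernel (π : Policy S A) (s s' : S) : ℝ :=
  ∑ a, π s a * M.trans s a s'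

theorem kernel_nonneg (π : Policy S A) (s s' : S) : 0 ≤ M.kernel π s s' :=
  sum_nonneg fun a _ => mul_nonneg (π.prob_nonneg s a) (M.trans_nonneg s a s')

theorem kernel_sum (π : Policy S A) (s : S) : ∑ s', M.kernel π s s' = 1 := by
  simp only [kernel]
  rw [sum_comm]
  simp only [← mul_sum, M.trans_sum, mul_one, π.prob_sum]

theorem stateDist_succ (π : Policy S A) (t : ℕ) (s' : S) :
    M.stateDist π (t + 1) s' = ∑ s, M.stateDist π t s * M.kernel π s s' :=
  rfl

theorem stateDist_nonneg (π : Policy S A) (t : ℕ) (s : S) : 0 ≤ M.stateDist π t s := by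
  induction t generalizing s with
  | zero => exact M.init_nonneg s
  | succ t ih => exact sum_nonneg fun s' _ => mul_nonneg (ih s') (M.kernel_nonneg π s' s)

theorem stateDist_sum (π : Policy S A) (t : ℕ) : ∑ s, M.stateDist π t s = 1 := by
  induction t with
  | zero => exact M.init_sum
  | succ t ih =>
    simp only [stateDist_succ]
    rw [sum_comm]
    simp only [← mul_sum, kernel_sum, mul_one, ih]

theorem summable_stateDist (π : Policy S A) (s : S) :
    Summable fun t : ℕ => M.γ ^ t * M.stateDist π t s := by
  refine Summable.of_nonneg_of_le
    (fun t => mul_nonneg (pow_nonneg M.γ_nonneg t) (M.stateDist_nonneg π t s)) (fun t => ?_)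
    (summable_geometric_of_lt_one M.γ_nonneg M.γ_lt_one)
  refine mul_le_of_le_one_right (pow_nonneg M.γ_nonneg t) ?_
  rw [← M.stateDist_sum π t]
  exact single_le_sum (fun s _ => M.stateDist_nonneg π t s) (mem_univ s)

theorem stateOcc_nonneg (π : Policy S A) (s : S) : 0 ≤ M.stateOcc π s :=
  tsum_nonneg fun t => mul_nonneg (pow_nonneg M.γ_nonneg t) (M.stateDist_nonneg π t s)

theorem stateOcc_flow (π : Policy S A) (s' : S) :
    M.stateOcc π s' = M.init s' + M.γ * ∑ s, M.stateOcc π s * M.kernel π s s' := by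
  rw [stateOcc, (M.summable_stateDist π s').tsum_eq_zero_add]
  congr 1
  · simp [stateDist]
  · simp only [stateOcc, ← tsum_mul_right]
    rw [← Summable.tsum_finsetSum fun s _ => (M.summable_stateDist π s).mul_right _,
      ← tsum_mul_left]
    refine tsum_congr fun t => ?_
    rw [stateDist_succ, mul_sum, mul_sum]
    refine sum_congr rfl fun s _ => ?_
    ring

theorem eq_stateOcc_of_flow (π : Policy S A) {x : S → ℝ}
    (hx : ∀ s', x s' = M.init s' + M.γ * ∑ s, x s * M.kernel π s s') (s : S) :
    x s = M.stateOcc π s := by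
  set d : S → ℝ := fun s => x s - M.stateOcc π s with hd
  have hflow : ∀ s', d s' = M.γ * ∑ s, d s * M.kernel π s s' := by
    intro s'
    simp only [hd, sub_mul, sum_sub_distrib]
    rw [hx s', M.stateOcc_flow π s']
    ring
  -- The kernel does not increase the `ℓ¹` norm, so `‖d‖₁ ≤ γ ‖d‖₁`.
  have hle : ∑ s', |d s'| ≤ M.γ * ∑ s, |d s| := by
    calc ∑ s', |d s'| ≤ ∑ s', M.γ * ∑ s, |d s| * M.kernel π s s' := by
          refine sum_le_sum fun s' _ => ?_
          rw [hflow s', abs_mul, abs_of_nonneg M.γ_nonneg]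
          refine mul_le_mul_of_nonneg_left ((abs_sum_le_sum_abs _ _).trans_eq ?_) M.γ_nonneg
          exact sum_congr rfl fun s _ => by rw [abs_mul, abs_of_nonneg (M.kernel_nonneg π s s')]
      _ = M.γ * ∑ s, |d s| := by
          rw [← mul_sum, sum_comm]
          simp only [← mul_sum, kernel_sum, mul_one]
  have h0 : 0 ≤ ∑ s, |d s| := sum_nonneg fun s _ => abs_nonneg _
  have hzero : ∑ s, |d s| = 0 := by nlinarith [M.γ_lt_one]
  have := (sum_eq_zero_iff_of_nonneg fun s _ => abs_nonneg (d s)).1 hzero s (mem_univ s)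
  exact sub_eq_zero.1 (abs_eq_zero.1 this)

theorem sum_stateOcc_mul (π : Policy S A) (v : S → ℝ) :
    ∑ s, M.stateOcc π s * v s = ∑ s, M.init s * v s +
      ∑ s, M.stateOcc π s * ∑ a, π s a * (M.γ * ∑ s', M.trans s a s' * v s') := by
  have hinner : ∀ s, ∑ a, π s a * (M.γ * ∑ s', M.trans s a s' * v s')
      = M.γ * ∑ s', M.kernel π s s' * v s' := by
    intro s
    simp only [kernel, sum_mul, mul_sum]
    rw [sum_comm]
    exact sum_congr rfl fun _ _ => sum_congr rfl fun _ _ => by ring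
  simp only [hinner]
  calc ∑ s', M.stateOcc π s' * v s'
      = ∑ s', (M.init s' * v s' + ∑ s, M.stateOcc π s * (M.γ * (M.kernel π s s' * v s'))) := by
        refine sum_congr rfl fun s' _ => ?_
        conv_lhs => rw [M.stateOcc_flow π s', add_mul, mul_sum, sum_mul]
        congr 1
        exact sum_congr rfl fun _ _ => by ring
    _ = _ := by
        rw [sum_add_distrib, sum_comm]
        simp only [mul_sum]

/-- A policy with full support wherever it goes visits every state that any policy visits. -/
theorem stateOcc_eq_zero_of_full_support {π₀ : Policy S A}
    (hpos : ∀ s, M.stateOcc π₀ s ≠ 0 → ∀ a, 0 < π₀ s a) {s : S} (hs : M.stateOcc π₀ s = 0)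
    (π : Policy S A) : M.stateOcc π s = 0 := by
  have hnn : ∀ s s', 0 ≤ M.stateOcc π₀ s * M.kernel π₀ s s' := fun s s' =>
    mul_nonneg (M.stateOcc_nonneg π₀ s) (M.kernel_nonneg π₀ s s')
  have hsplit : ∀ s', M.stateOcc π₀ s' = 0 → M.init s' = 0 ∧
      M.γ * ∑ s, M.stateOcc π₀ s * M.kernel π₀ s s' = 0 := by
    intro s' hs'
    rw [M.stateOcc_flow π₀ s'] at hs'
    exact (add_eq_zero_iff_of_nonneg (M.init_nonneg s')
      (mul_nonneg M.γ_nonneg (sum_nonneg fun s _ => hnn s s'))).1 hs'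
  have hstep : ∀ s', M.stateOcc π₀ s' = 0 → ∀ s, M.stateOcc π₀ s ≠ 0 → ∀ a,
      M.γ * M.trans s a s' = 0 := by
    intro s' hs' s hs a
    rcases mul_eq_zero.1 (hsplit s' hs').2 with h | h
    · rw [h, zero_mul]
    · have h1 := (sum_eq_zero_iff_of_nonneg fun s _ => hnn s s').1 h s (mem_univ s)
      have h2 := (mul_eq_zero.1 h1).resolve_left hs
      have h3 := (sum_eq_zero_iff_of_nonneg fun a _ =>
        mul_nonneg (π₀.prob_nonneg s a) (M.trans_nonneg s a s')).1 h2 a (mem_univ a)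
      rw [(mul_eq_zero.1 h3).resolve_left (hpos s hs a).ne', mul_zero]
  have hzero : ∀ t s', M.stateOcc π₀ s' = 0 → M.γ ^ t * M.stateDist π t s' = 0 := by
    intro t
    induction t with
    | zero =>
      intro s' hs'
      simpa [stateDist] using (hsplit s' hs').1
    | succ t ih =>
      intro s' hs'
      rw [stateDist_succ, mul_sum]
      refine sum_eq_zero fun s _ => ?_
      by_cases hs : M.stateOcc π₀ s = 0
      · calc M.γ ^ (t + 1) * (M.stateDist π t s * M.kernel π s s')
            = M.γ ^ t * M.stateDist π t s * (M.γ * M.kernel π s s') := by ring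
          _ = 0 := by rw [ih s hs, zero_mul]
      · have hk : M.γ * M.kernel π s s' = 0 := by
          rw [kernel, mul_sum]
          refine sum_eq_zero fun a _ => ?_
          rw [mul_left_comm, hstep s' hs' s hs a, mul_zero]
        calc M.γ ^ (t + 1) * (M.stateDist π t s * M.kernel π s s')
            = M.γ ^ t * M.stateDist π t s * (M.γ * M.kernel π s s') := by ring
          _ = 0 := by rw [hk, mul_zero]
  rw [stateOcc]
  simp only [hzero _ s hs, tsum_zero]

/-! ### Mixtures of occupancies -/

theorem entropy_eq_sum_negMulLog (p : A → ℝ) : entropy p = ∑ a, negMulLog (p a) := by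
  simp [entropy, negMulLog, sum_neg_distrib]

/-- Convex combinations of occupancies are occupancies, and every maximum-causal-entropy
objective is concave along them. The mixing policy does not depend on the reward. -/
theorem exists_mixture (π₁ π₂ : Policy S A) {t : ℝ} (ht0 : 0 ≤ t) (ht1 : t ≤ 1) :
    ∃ π : Policy S A, ∀ r : S → A → ℝ,
      t * M.mceObjective r π₁ + (1 - t) * M.mceObjective r π₂ ≤ M.mceObjective r π := by
  classical
  set x : S → ℝ := fun s => M.stateOcc π₁ s
  set y : S → ℝ := fun s => M.stateOcc π₂ s
  have hx : ∀ s, 0 ≤ t * x s := fun s => mul_nonneg ht0 (M.stateOcc_nonneg π₁ s)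
  have hy : ∀ s, 0 ≤ (1 - t) * y s := fun s =>
    mul_nonneg (sub_nonneg.2 ht1) (M.stateOcc_nonneg π₂ s)
  set z : S → ℝ := fun s => t * x s + (1 - t) * y s with hz
  have hz0 : ∀ s, 0 ≤ z s := fun s => add_nonneg (hx s) (hy s)
  -- At states of zero occupancy the conditional law is arbitrary.
  let π : Policy S A :=
    { prob := fun s a => if z s = 0 then π₁ s a else
        (t * x s / z s) * π₁ s a + ((1 - t) * y s / z s) * π₂ s a
      prob_nonneg := fun s a => by
        split_ifs
        · exact π₁.prob_nonneg s a
        · exact add_nonneg (mul_nonneg (div_nonneg (hx s) (hz0 s)) (π₁.prob_nonneg s a))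
            (mul_nonneg (div_nonneg (hy s) (hz0 s)) (π₂.prob_nonneg s a))
      prob_sum := fun s => by
        split_ifs with h
        · exact π₁.prob_sum s
        · rw [sum_add_distrib, ← mul_sum, ← mul_sum, π₁.prob_sum, π₂.prob_sum, mul_one, mul_one,
            ← add_div]
          exact div_self h }
  have hπ : ∀ s, z s ≠ 0 → ∀ a,
      π s a = (t * x s / z s) * π₁ s a + ((1 - t) * y s / z s) * π₂ s a :=
    fun s h a => if_neg h
  have hvanish : ∀ s, z s = 0 → t * x s = 0 ∧ (1 - t) * y s = 0 := fun s h =>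
    (add_eq_zero_iff_of_nonneg (hx s) (hy s)).1 h
  have hocc : ∀ s a, z s * π s a = t * x s * π₁ s a + (1 - t) * y s * π₂ s a := by
    intro s a
    by_cases h : z s = 0
    · rw [h, (hvanish s h).1, (hvanish s h).2]
      ring
    · rw [hπ s h a]
      field_simp
  have hlin : ∀ (s : S) (c : A → ℝ), z s * ∑ a, π s a * c a =
      t * (x s * ∑ a, π₁ s a * c a) + (1 - t) * (y s * ∑ a, π₂ s a * c a) := by
    intro s c
    simp only [mul_sum, ← sum_add_distrib]
    refine sum_congr rfl fun a _ => ?_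
    rw [← mul_assoc, hocc]
    ring
  have hzocc : ∀ s, z s = M.stateOcc π s := by
    refine M.eq_stateOcc_of_flow π fun s' => ?_
    have hk : ∀ s, z s * M.kernel π s s' =
        t * (x s * M.kernel π₁ s s') + (1 - t) * (y s * M.kernel π₂ s s') := fun s => hlin s _
    simp only [hk, sum_add_distrib, ← mul_sum]
    have h1 : x s' = _ := M.stateOcc_flow π₁ s'
    have h2 : y s' = _ := M.stateOcc_flow π₂ s'
    simp only [hz]
    rw [h1, h2]
    ring
  have hent : ∀ s, t * (x s * entropy (π₁ s)) + (1 - t) * (y s * entropy (π₂ s)) ≤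
      z s * entropy (π s) := by
    intro s
    by_cases h : z s = 0
    · rw [h, ← mul_assoc, ← mul_assoc, (hvanish s h).1, (hvanish s h).2]
      simp
    · simp only [entropy_eq_sum_negMulLog, mul_sum, ← sum_add_distrib]
      refine sum_le_sum fun a _ => ?_
      have hpos : 0 < z s := lt_of_le_of_ne (hz0 s) (Ne.symm h)
      have hc := concaveOn_negMulLog.2 (Set.mem_Ici.2 (π₁.prob_nonneg s a))
        (Set.mem_Ici.2 (π₂.prob_nonneg s a)) (div_nonneg (hx s) (hz0 s))
        (div_nonneg (hy s) (hz0 s)) (by rw [← add_div]; exact div_self h)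
      simp only [smul_eq_mul] at hc
      rw [← hπ s h a] at hc
      refine le_trans (le_of_eq ?_) (mul_le_mul_of_nonneg_left hc hpos.le)
      field_simp
  refine ⟨π, fun r => ?_⟩
  have hobj : M.mceObjective r π =
      ∑ s, (z s * entropy (π s) + z s * ∑ a, π s a * r s a) := by
    simp only [mceObjective, sum_add_distrib, hzocc]
  rw [hobj, mceObjective, mceObjective]
  simp only [← sum_add_distrib, mul_sum (s := (univ : Finset S))]
  refine sum_le_sum fun s _ => ?_
  rw [hlin s (r s)]
  have := hent s
  simp only [x, y] at *
  linarith

/-! ### The soft Bellman equation -/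

/-- The state-action value `r(s, a) + γ ∑ P(s' | s, a) v(s')` of a state value `v`. -/
def qValue (r : S → A → ℝ) (v : S → ℝ) (s : S) (a : A) : ℝ :=
  r s a + M.γ * ∑ s', M.trans s a s' * v s'

/-- The soft Bellman operator: the maximum of the Bellman operator is replaced by log-sum-exp. -/
noncomputable def softBellman (r : S → A → ℝ) (v : S → ℝ) (s : S) : ℝ :=
  log (∑ a, exp (M.qValue r v s a))

theorem qValue_le_add (r : S → A → ℝ) {v w : S → ℝ} {c : ℝ} (h : ∀ s, v s ≤ w s + c)
    (s : S) (a : A) : M.qValue r v s a ≤ M.qValue r w s a + M.γ * c := by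
  have h1 : ∑ s', M.trans s a s' * v s' ≤ ∑ s', M.trans s a s' * w s' + c := by
    calc ∑ s', M.trans s a s' * v s' ≤ ∑ s', M.trans s a s' * (w s' + c) :=
          sum_le_sum fun s' _ => mul_le_mul_of_nonneg_left (h s') (M.trans_nonneg s a s')
      _ = _ := by simp only [mul_add, sum_add_distrib, ← sum_mul, M.trans_sum, one_mul]
  have h2 := mul_le_mul_of_nonneg_left h1 M.γ_nonneg
  simp only [qValue]
  linarith

theorem softBellman_le_add [Nonempty A] (r : S → A → ℝ) {v w : S → ℝ} {c : ℝ}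
    (h : ∀ s, v s ≤ w s + c) (s : S) :
    M.softBellman r v s ≤ M.softBellman r w s + M.γ * c := by
  have hpos : ∀ u : S → ℝ, 0 < ∑ a, exp (M.qValue r u s a) := fun u =>
    sum_pos (fun a _ => exp_pos _) univ_nonempty
  rw [softBellman, log_le_iff_le_exp (hpos v), exp_add, softBellman, exp_log (hpos w), sum_mul]
  refine sum_le_sum fun a _ => ?_
  rw [← exp_add]
  exact exp_le_exp.2 (M.qValue_le_add r h s a)

theorem exists_softBellman_fixedPoint [Nonempty A] (r : S → A → ℝ) :
    ∃ v : S → ℝ, M.softBellman r v = v := by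
  have hdist : ∀ u u' : S → ℝ, ∀ s, u s ≤ u' s + dist u u' := fun u u' s => by
    have h1 := dist_le_pi_dist u u' s
    have h2 := le_abs_self (u s - u' s)
    rw [Real.dist_eq] at h1
    linarith
  have hc : ContractingWith ⟨M.γ, M.γ_nonneg⟩ (M.softBellman r) := by
    refine ⟨M.γ_lt_one, LipschitzWith.of_dist_le_mul fun v w => ?_⟩
    refine (dist_pi_le_iff (mul_nonneg M.γ_nonneg dist_nonneg)).2 fun s => ?_
    rw [Real.dist_eq, abs_sub_le_iff]
    have h1 := M.softBellman_le_add r (hdist v w) s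
    have h2 := M.softBellman_le_add r (hdist w v) s
    rw [dist_comm w v] at h2
    constructor
    · exact sub_le_iff_le_add'.2 h1
    · exact sub_le_iff_le_add'.2 h2
  exact ⟨_, hc.fixedPoint_isFixedPt⟩

/-- The Boltzmann policy `exp (q - v)` of a solution `v` of the soft Bellman equation. -/
noncomputable def softPolicy [Nonempty A] (r : S → A → ℝ) (v : S → ℝ)
    (hv : M.softBellman r v = v) : Policy S A where
  prob s a := exp (M.qValue r v s a - v s)
  prob_nonneg _ _ := (exp_pos _).le
  prob_sum s := by
    have hpos : 0 < ∑ a, exp (M.qValue r v s a) := sum_pos (fun a _ => exp_pos _) univ_nonempty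
    have h : exp (v s) = ∑ a, exp (M.qValue r v s a) := by
      rw [← exp_log hpos]
      exact congrArg exp (congrFun hv s).symm
    simp only [exp_sub]
    rw [← sum_div, h, div_self hpos.ne']

theorem softPolicy_pos [Nonempty A] (r : S → A → ℝ) (v : S → ℝ) (hv : M.softBellman r v = v)
    (s : S) (a : A) : 0 < M.softPolicy r v hv s a :=
  exp_pos _

/-- The performance gap of a policy is its expected divergence from the Boltzmann policy: the
flow equation telescopes `log π* = q - v`. -/
theorem mceObjective_eq_sub_klReal [Nonempty A] (r : S → A → ℝ) (v : S → ℝ)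
    (hv : M.softBellman r v = v) (π : Policy S A) :
    M.mceObjective r π = ∑ s, M.init s * v s -
      ∑ s, M.stateOcc π s * klReal (π s) (M.softPolicy r v hv s) := by
  have hkl : ∀ s, klReal (π s) (M.softPolicy r v hv s) = -entropy (π s) - ∑ a, π s a * r s a -
      ∑ a, π s a * (M.γ * ∑ s', M.trans s a s' * v s') + v s := by
    intro s
    have hterm : ∀ a, π s a * log (π s a / M.softPolicy r v hv s a) =
        π s a * log (π s a) - π s a * r s a -
          π s a * (M.γ * ∑ s', M.trans s a s' * v s') + π s a * v s := by
      intro a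
      by_cases h : π s a = 0
      · simp [h]
      · rw [log_div h (M.softPolicy_pos r v hv s a).ne',
          show log (M.softPolicy r v hv s a) = M.qValue r v s a - v s from log_exp _, qValue]
        ring
    simp only [klReal, hterm, sum_add_distrib, sum_sub_distrib, ← sum_mul, π.prob_sum, one_mul,
      entropy, neg_neg]
  have hflow := M.sum_stateOcc_mul π v
  simp only [hkl, mul_add, mul_sub, mul_neg, sum_add_distrib, sum_sub_distrib, sum_neg_distrib,
    mceObjective]
  linarith

/-! ### Divergence from an optimal policy -/

/-- An optimal policy agrees with a Boltzmann policy at every state it visits. -/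
theorem IsMCEOptimal.eq_softPolicy [Nonempty A] {M : MDP S A} {r : S → A → ℝ} {π₀ : Policy S A}
    (h : M.IsMCEOptimal r π₀) {v : S → ℝ} (hv : M.softBellman r v = v) {s : S}
    (hs : M.stateOcc π₀ s ≠ 0) : π₀ s = M.softPolicy r v hv s := by
  have hnn : ∀ s, 0 ≤ klReal (π₀ s) (M.softPolicy r v hv s) := fun s =>
    klReal_nonneg (π₀.prob_nonneg s) (M.softPolicy_pos r v hv s)
      (by rw [π₀.prob_sum, (M.softPolicy r v hv).prob_sum])
  have hle := h (M.softPolicy r v hv)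
  rw [M.mceObjective_eq_sub_klReal r v hv, M.mceObjective_eq_sub_klReal r v hv] at hle
  simp only [klReal_self, mul_zero, sum_const_zero, sub_zero] at hle
  have hterm : ∀ s ∈ univ, 0 ≤ M.stateOcc π₀ s * klReal (π₀ s) (M.softPolicy r v hv s) :=
    fun s _ => mul_nonneg (M.stateOcc_nonneg π₀ s) (hnn s)
  have hzero := le_antisymm (by linarith) (sum_nonneg hterm)
  have hs0 := (sum_eq_zero_iff_of_nonneg hterm).1 hzero s (mem_univ s)
  exact eq_of_klReal_eq_zero (π₀.prob_nonneg s) (M.softPolicy_pos r v hv s)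
    (by rw [π₀.prob_sum, (M.softPolicy r v hv).prob_sum]) ((mul_eq_zero.1 hs0).resolve_left hs)

/-- The expected divergence from an optimal policy is the loss in the objective; in particular it
is finite, since an optimal policy has full support at all states that any policy visits. -/
theorem expectedKL_eq {r : S → A → ℝ} {π₀ : Policy S A} (h : M.IsMCEOptimal r π₀)
    (π : Policy S A) :
    M.expectedKL π π₀ = ((M.mceObjective r π₀ - M.mceObjective r π : ℝ) : EReal) := by
  have hS : Nonempty S := by
    by_contra hS
    rw [not_nonempty_iff] at hS
    simpa using M.init_sum
  have hA : Nonempty A := by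
    by_contra hA
    rw [not_nonempty_iff] at hA
    simpa using π.prob_sum hS.some
  obtain ⟨v, hv⟩ := M.exists_softBellman_fixedPoint r
  have hvis : ∀ s, M.stateOcc π₀ s ≠ 0 → π₀ s = M.softPolicy r v hv s := fun s hs =>
    h.eq_softPolicy hv hs
  have hunvis : ∀ s, M.stateOcc π₀ s = 0 → ∀ π', M.stateOcc π' s = 0 := fun s hs =>
    M.stateOcc_eq_zero_of_full_support
      (fun s hs a => (hvis s hs).symm ▸ M.softPolicy_pos r v hv s a) hs
  have hterm : ∀ s, (M.stateOcc π s : EReal) * kl (π s) (π₀ s) =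
      ((M.stateOcc π s * klReal (π s) (M.softPolicy r v hv s) : ℝ) : EReal) := by
    intro s
    by_cases hs : M.stateOcc π₀ s = 0
    · simp [hunvis s hs π]
    · rw [hvis s hs, kl_of_pos (M.softPolicy_pos r v hv s), EReal.coe_mul]
  have hself : ∑ s, M.stateOcc π₀ s * klReal (π₀ s) (M.softPolicy r v hv s) = 0 := by
    refine sum_eq_zero fun s _ => ?_
    by_cases hs : M.stateOcc π₀ s = 0
    · rw [hs, zero_mul]
    · rw [hvis s hs, klReal_self, mul_zero]
  rw [M.mceObjective_eq_sub_klReal r v hv π, M.mceObjective_eq_sub_klReal r v hv π₀, hself,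
    expectedKL]
  simp only [hterm, sub_zero, sub_sub_cancel]
  exact (map_sum (⟨⟨Real.toEReal, EReal.coe_zero⟩, EReal.coe_add⟩ : ℝ →+ EReal) _ _).symm

/-! ### The Lagrangian as a rescaled entropy objective -/

theorem lagrangian_eq {r r' : S → A → ℝ} {π₀ : Policy S A} (h : M.IsMCEOptimal r π₀)
    (ζ η : ℝ) (π : Policy S A) :
    M.lagrangian r' π₀ ζ η π = ((M.mceObjective r' π +
      η * (ζ - (M.mceObjective r π₀ - M.mceObjective r π)) : ℝ) : EReal) := by
  rw [lagrangian, M.expectedKL_eq h]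
  norm_cast

/-- The objective is affine in the reward, and the correction of the step size amounts to
averaging the updated and the old reward with weights `1` and `η`. -/
theorem mceObjective_rewardUpdate (ε β : ℝ) {η : ℝ} (hη : 0 ≤ η) (πE π₀ : Policy S A)
    (r : S → A → ℝ) (π : Policy S A) :
    (1 + η) * M.mceObjective (M.rewardUpdate (ε / (1 + η)) β πE π₀ r) π =
      M.mceObjective (M.rewardUpdate ε β πE π₀ r) π + η * M.mceObjective r π := by
  have hne : 1 + η ≠ 0 := by positivity
  have hr : ∀ s a, (1 + η) * M.rewardUpdate (ε / (1 + η)) β πE π₀ r s a =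
      M.rewardUpdate ε β πE π₀ r s a + η * r s a := by
    intro s a
    simp only [rewardUpdate]
    field_simp
    ring
  have hlin : (1 + η) * ∑ s, M.stateOcc π s *
      ∑ a, π s a * M.rewardUpdate (ε / (1 + η)) β πE π₀ r s a =
      ∑ s, M.stateOcc π s * ∑ a, π s a * M.rewardUpdate ε β πE π₀ r s a +
        η * ∑ s, M.stateOcc π s * ∑ a, π s a * r s a := by
    simp only [mul_sum, ← sum_add_distrib]
    refine sum_congr rfl fun s _ => sum_congr rfl fun a _ => ?_
    linear_combination M.stateOcc π s * π s a * hr s a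
  simp only [mceObjective]
  linear_combination hlin

theorem exists_isLagrangeMultiplier {r r' : S → A → ℝ} {π₀ π : Policy S A} {ζ : ℝ} (hζ : 0 < ζ)
    (h : M.IsMCEOptimal r π₀) (hπ : M.IsTrustRegionOptimal r' π₀ ζ π) :
    ∃ η : ℝ, M.IsLagrangeMultiplier r' π₀ ζ π η := by
  obtain ⟨hfeas, hmax⟩ := hπ
  simp only [M.expectedKL_eq h, EReal.coe_le_coe_iff] at hfeas hmax
  obtain ⟨η, hη, hopt, hslack⟩ := exists_multiplier_of_concave
    (f := M.mceObjective r') (g := fun π' => M.mceObjective r π₀ - M.mceObjective r π')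
    (x₀ := π₀) (x := π) (ζ := ζ)
    (fun y z t ht0 ht1 => by
      obtain ⟨w, hw⟩ := M.exists_mixture y z ht0 ht1
      exact ⟨w, hw r', by linarith [hw r]⟩)
    (by simpa using hζ) hfeas hmax
  refine ⟨η, hη, fun π' => ?_, ?_⟩
  · rw [M.lagrangian_eq h, M.lagrangian_eq h, EReal.coe_le_coe_iff, hslack, add_zero]
    exact hopt π'
  · rw [M.expectedKL_eq h]
    exact_mod_cast hslack

end MDP

end TRIRL

theorem theorem1 {S A : Type*} [Fintype S] [Fintype A] (M : TRIRL.MDP S A)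
    (πE πi πtr : TRIRL.Policy S A) (ri : S → A → ℝ) (ε β ζ : ℝ)
    (hε : 0 < ε) (hζ : 0 < ζ)
    (hi : M.IsMCEOptimal ri πi)
    (htr : M.IsTrustRegionOptimal (M.rewardUpdate ε β πE πi ri) πi ζ πtr) :
    (∃ η : ℝ, M.IsLagrangeMultiplier (M.rewardUpdate ε β πE πi ri) πi ζ πtr η) ∧
      ∀ η : ℝ, M.IsLagrangeMultiplier (M.rewardUpdate ε β πE πi ri) πi ζ πtr η →
        0 < ε / (1 + η) ∧ ε / (1 + η) ≤ ε ∧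
          M.IsMCEOptimal (M.rewardUpdate (ε / (1 + η)) β πE πi ri) πtr := by
  refine ⟨M.exists_isLagrangeMultiplier hζ hi htr, ?_⟩
  rintro η ⟨hη, hopt, -⟩
  have hpos : 0 < 1 + η := by positivity
  refine ⟨div_pos hε hpos, div_le_self hε.le (by linarith), fun π => ?_⟩
  have h := hopt π
  rw [M.lagrangian_eq hi, M.lagrangian_eq hi, EReal.coe_le_coe_iff] at h
  refine le_of_mul_le_mul_left ?_ hpos
  rw [M.mceObjective_rewardUpdate ε β hη, M.mceObjective_rewardUpdate ε β hη]
  linarith
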